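/- **Theorem 1.3.** Let $(X,\le)$ be a poset and $K$ a field. Let $FI(X,K)$ be the finitary incidence algebra of $X$ over $K$: the $K$-algebra of all formal sums $\alpha=\sum_{x\le y}\alpha_{xy}e_{xy}$ with $\alpha_{xy}\in K$ such that for each pair $x<y$ in $X$ there are only finitely many pairs $(u,v)$ with $x\le u<v\le y$ and $\alpha_{uv}\ne 0$, with product $$\alpha\beta=\sum_{x\le y}\Bigl(\sum_{x\le z\le y}\alpha_{xz}\beta_{zy}\Bigr)e_{xy}$$ and identity element $\sum_{x\in X}e_{xx}$. Let $\mathcal U(FI(X,K))$ be its group of units. Then the following conditions are equivalent: 1. $FI(X,K)$ satisfies a polynomial identity; 2. $FI(X,K)$ is Lie solvable; 3. $FI(X,K)$ is strongly Lie solvable; 4. $\mathcal U(FI(X,K))$ satisfies a group identity; 5. $\mathcal U(FI(X,K))$ is solvable; 6. $X$ is bounded. Here a $K$-algebra $A$ satisfies a polynomial identity if there is a nonzero $f(x_1,\dots,x_n)$ in the free associative unital algebra $K\langle x_1,x_2,\dots\rangle$ with $f(a_1,\dots,a_n)=0$ for all $a_1,\dots,a_n\in A$; a group $G$ satisfies a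 group identity if there is a nontrivial element $w(x_1,\dots,x_n)$ of the free group on $\{x_1,x_2,\dots\}$ with $w(g_1,\dots,g_n)=1$ for all $g_1,\dots,g_n\in G$. For subspaces $U,V$ of $A$, write $[U,V]$ and $UV$ for the linear spans of all $uv-vu$ and of all $uv$ with $u\in U$, $v\in V$. The algebra $A$ is Lie solvable if $A^{[n]}=0$ for some $n$, where $A^{[0]}=A$ and $A^{[n+1]}=[A^{[n]},A^{[n]}]$, and strongly Lie solvable if $A^{(n)}=0$ for some $n$, where $A^{(0)}=A$ and $A^{(n+1)}=[A^{(n)},A^{(n)}]A$. The poset $X$ is bounded if its length, the supremum of $|C|-1$ over all finite chains $C\subseteq X$, is finite. -/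

import Mathlib

/-- The finitary series over a poset `X`, as a subspace of the space `IncidenceAlgebra K X` of all
formal sums `∑_{x ≤ y} α_{xy} e_{xy}` (functions `α : X → X → K` with `α x y = 0` unless `x ≤ y`):
for any pair `x < y` there are only finitely many `x ≤ u < v ≤ y` with `α_{uv} ≠ 0`.
No local finiteness of `X` is assumed. -/
def finitarySeries (X K : Type*) [PartialOrder X] [CommRing K] :
    Submodule K (IncidenceAlgebra K X) where
  carrier := {α | ∀ x y : X, x < y →
    {p : X × X | x ≤ p.1 ∧ p.1 < p.2 ∧ p.2 ≤ y ∧ α p.1 p.2 ≠ 0}.Finite}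
  zero_mem' := by
    intro x y _
    simp
  add_mem' := by
    intro α β hα hβ x y hxy
    refine ((hα x y hxy).union (hβ x y hxy)).subset ?_
    rintro ⟨u, v⟩ ⟨h1, h2, h3, h4⟩
    simp only [Set.mem_union, Set.mem_ofPred_eq]
    by_contra! h
    apply h4
    rw [IncidenceAlgebra.add_apply]
    simp [h.1 h1 h2 h3, h.2 h1 h2 h3]
  smul_mem' := by
    intro c α hα x y hxy
    refine (hα x y hxy).subset ?_
    rintro ⟨u, v⟩ ⟨h1, h2, h3, h4⟩
    refine ⟨h1, h2, h3, fun h => h4 ?_⟩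
    rw [IncidenceAlgebra.constSMul_apply, h, smul_zero]

/-- The finitary incidence algebra `FI(X, K)`. -/
def FinitaryIncidenceAlgebra (X K : Type*) [PartialOrder X] [CommRing K] : Type _ :=
  ↥(finitarySeries X K)

namespace FinitaryIncidenceAlgebra

section Construction

variable {X K : Type*} [PartialOrder X] [CommRing K]

instance : AddCommGroup (FinitaryIncidenceAlgebra X K) :=
  inferInstanceAs (AddCommGroup ↥(finitarySeries X K))

instance : Module K (FinitaryIncidenceAlgebra X K) :=
  inferInstanceAs (Module K ↥(finitarySeries X K))

/-- The coefficient `α_{xy}`. -/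
def coeff (α : FinitaryIncidenceAlgebra X K) (x y : X) : K := α.1 x y

theorem coeff_of_not_le (α : FinitaryIncidenceAlgebra X K) {x y : X} (h : ¬ x ≤ y) :
    α.coeff x y = 0 :=
  IncidenceAlgebra.apply_eq_zero_of_not_le h α.1

theorem le_of_coeff_ne_zero (α : FinitaryIncidenceAlgebra X K) {x y : X}
    (h : α.coeff x y ≠ 0) : x ≤ y := by
  by_contra hxy
  exact h (α.coeff_of_not_le hxy)

theorem finite_coeff (α : FinitaryIncidenceAlgebra X K) (x y : X) :
    {p : X × X | x ≤ p.1 ∧ p.1 < p.2 ∧ p.2 ≤ y ∧ α.coeff p.1 p.2 ≠ 0}.Finite := by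
  by_cases h : x < y
  · exact α.2 x y h
  · refine Set.finite_empty.subset ?_
    rintro ⟨u, v⟩ ⟨h1, h2, h3, -⟩
    exact h (lt_of_le_of_lt h1 (lt_of_lt_of_le h2 h3))

@[ext]
theorem ext {α β : FinitaryIncidenceAlgebra X K} (h : ∀ x y, α.coeff x y = β.coeff x y) :
    α = β :=
  Subtype.ext (DFunLike.ext _ _ fun x => funext fun y => h x y)

@[simp]
theorem coeff_add (α β : FinitaryIncidenceAlgebra X K) (x y : X) :
    (α + β).coeff x y = α.coeff x y + β.coeff x y := rfl

@[simp]
theorem coeff_zero (x y : X) : (0 : FinitaryIncidenceAlgebra X K).coeff x y = 0 := rfl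

@[simp]
theorem coeff_smul (c : K) (α : FinitaryIncidenceAlgebra X K) (x y : X) :
    (c • α).coeff x y = c * α.coeff x y := rfl

open Classical in
/-- The identity element `δ = ∑_x e_{xx}`. -/
noncomputable instance : One (FinitaryIncidenceAlgebra X K) where
  one := ⟨⟨fun x y => if x = y then 1 else 0, fun _ _ h => if_neg fun e => h e.le⟩, by
    intro x y _
    refine Set.finite_empty.subset ?_
    rintro ⟨u, v⟩ ⟨-, h2, -, h4⟩
    exact h4 (if_neg h2.ne)⟩

open Classical in
theorem coeff_one (x y : X) :
    (1 : FinitaryIncidenceAlgebra X K).coeff x y = if x = y then 1 else 0 := rfl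

/-- In the convolution sum only finitely many terms are non-zero. -/
theorem finite_conv (α β : FinitaryIncidenceAlgebra X K) (x y : X) :
    (Function.support fun z => α.coeff x z * β.coeff z y).Finite := by
  refine (((α.finite_coeff x y).image Prod.snd).union (Set.finite_singleton x)).subset ?_
  intro z hz
  have h1 : α.coeff x z ≠ 0 := left_ne_zero_of_mul hz
  have h2 : β.coeff z y ≠ 0 := right_ne_zero_of_mul hz
  have hxz := α.le_of_coeff_ne_zero h1
  have hzy := β.le_of_coeff_ne_zero h2
  rcases hxz.eq_or_lt with h | h
  · exact Or.inr h.symm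
  · exact Or.inl ⟨(x, z), ⟨le_rfl, h, hzy, h1⟩, rfl⟩

/-- The convolution `(αβ)_{xy} = ∑_{x ≤ z ≤ y} α_{xz} β_{zy}`, a finite sum by `finite_conv`; the
terms with `z` outside of the interval from `x` to `y` vanish. -/
noncomputable instance : Mul (FinitaryIncidenceAlgebra X K) where
  mul α β := ⟨⟨fun x y => ∑ᶠ z, α.coeff x z * β.coeff z y, by
      intro x y h
      refine finsum_eq_zero_of_forall_eq_zero fun z => ?_
      by_cases hz : x ≤ z
      · rw [β.coeff_of_not_le fun hzy => h (hz.trans hzy), mul_zero]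
      · rw [α.coeff_of_not_le hz, zero_mul]⟩, by
    intro x y _
    have hα := α.finite_coeff x y
    have hβ := β.finite_coeff x y
    refine ((hα.union hβ).union
      ((hα.prod hβ).image fun q : (X × X) × (X × X) => (q.1.1, q.2.2))).subset ?_
    rintro ⟨u, v⟩ ⟨h1, h2, h3, h4⟩
    obtain ⟨z, hz⟩ : ∃ z, α.coeff u z * β.coeff z v ≠ 0 := by
      by_contra! h
      exact h4 (finsum_eq_zero_of_forall_eq_zero h)
    have ha : α.coeff u z ≠ 0 := left_ne_zero_of_mul hz
    have hb : β.coeff z v ≠ 0 := right_ne_zero_of_mul hz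
    have huz := α.le_of_coeff_ne_zero ha
    have hzv := β.le_of_coeff_ne_zero hb
    dsimp only at h1 h2 h3
    rcases huz.eq_or_lt with rfl | huz'
    · exact Or.inl (Or.inr ⟨h1, h2, h3, hb⟩)
    · rcases hzv.eq_or_lt with rfl | hzv'
      · exact Or.inl (Or.inl ⟨h1, h2, h3, ha⟩)
      · exact Or.inr ⟨((u, z), (z, v)), ⟨⟨h1, huz', hzv.trans h3, ha⟩,
          ⟨h1.trans huz, hzv', h3, hb⟩⟩, rfl⟩⟩

theorem coeff_mul (α β : FinitaryIncidenceAlgebra X K) (x y : X) :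
    (α * β).coeff x y = ∑ᶠ z, α.coeff x z * β.coeff z y := rfl

protected theorem mul_assoc (α β γ : FinitaryIncidenceAlgebra X K) :
    α * β * γ = α * (β * γ) := by
  classical
  ext x y
  have hα := α.finite_coeff x y
  have hβ := β.finite_coeff x y
  let S : Finset X := {x, y} ∪ hα.toFinset.image Prod.snd ∪ hβ.toFinset.image Prod.snd
  have hxS : x ∈ S := by simp [S]
  have hyS : y ∈ S := by simp [S]
  have key : ∀ u v : X, u ∈ S → x ≤ u → v ≤ y → ∀ δ ε : FinitaryIncidenceAlgebra X K,
      (δ = α ∨ δ = β) →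
      (δ * ε).coeff u v = ∑ z ∈ S, δ.coeff u z * ε.coeff z v := by
    intro u v hu hxu hvy δ ε hδ
    rw [coeff_mul]
    refine finsum_eq_sum_of_support_subset _ fun z hz => ?_
    have h1 : δ.coeff u z ≠ 0 := left_ne_zero_of_mul hz
    have hzv := ε.le_of_coeff_ne_zero (right_ne_zero_of_mul hz)
    rcases (δ.le_of_coeff_ne_zero h1).eq_or_lt with rfl | h
    · exact hu
    · rcases hδ with rfl | rfl
      · exact Finset.mem_union_left _ (Finset.mem_union_right _ (Finset.mem_image.2
          ⟨(u, z), hα.mem_toFinset.2 ⟨hxu, h, hzv.trans hvy, h1⟩, rfl⟩))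
      · exact Finset.mem_union_right _ (Finset.mem_image.2
          ⟨(u, z), hβ.mem_toFinset.2 ⟨hxu, h, hzv.trans hvy, h1⟩, rfl⟩)
  have hl : (α * β * γ).coeff x y = ∑ z ∈ S, (α * β).coeff x z * γ.coeff z y := by
    rw [coeff_mul]
    refine finsum_eq_sum_of_support_subset _ fun z hz => ?_
    have h1 : (α * β).coeff x z ≠ 0 := left_ne_zero_of_mul hz
    have hzy := γ.le_of_coeff_ne_zero (right_ne_zero_of_mul hz)
    rw [key x z hxS le_rfl hzy α β (Or.inl rfl)] at h1
    obtain ⟨w, hw, h2⟩ := Finset.exists_ne_zero_of_sum_ne_zero h1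
    have h3 : β.coeff w z ≠ 0 := right_ne_zero_of_mul h2
    have hxw := α.le_of_coeff_ne_zero (left_ne_zero_of_mul h2)
    rcases (β.le_of_coeff_ne_zero h3).eq_or_lt with rfl | h
    · exact hw
    · exact Finset.mem_union_right _ (Finset.mem_image.2
        ⟨(w, z), hβ.mem_toFinset.2 ⟨hxw, h, hzy, h3⟩, rfl⟩)
  rw [hl, key x y hxS le_rfl le_rfl α (β * γ) (Or.inl rfl)]
  have e1 : ∀ z ∈ S, (α * β).coeff x z * γ.coeff z y =
      ∑ w ∈ S, α.coeff x w * (β.coeff w z * γ.coeff z y) := by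
    intro z _
    by_cases hzy : z ≤ y
    · rw [key x z hxS le_rfl hzy α β (Or.inl rfl), Finset.sum_mul]
      exact Finset.sum_congr rfl fun w _ => mul_assoc _ _ _
    · simp [γ.coeff_of_not_le hzy]
  have e2 : ∀ w ∈ S, α.coeff x w * (β * γ).coeff w y =
      ∑ z ∈ S, α.coeff x w * (β.coeff w z * γ.coeff z y) := by
    intro w hw
    by_cases hxw : x ≤ w
    · rw [key w y hw hxw le_rfl β γ (Or.inr rfl), Finset.mul_sum]
    · simp [α.coeff_of_not_le hxw]
  rw [Finset.sum_congr rfl e1, Finset.sum_congr rfl e2, Finset.sum_comm]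

noncomputable instance : Ring (FinitaryIncidenceAlgebra X K) :=
  { (inferInstance : AddCommGroup (FinitaryIncidenceAlgebra X K)),
    (inferInstance : One (FinitaryIncidenceAlgebra X K)),
    (inferInstance : Mul (FinitaryIncidenceAlgebra X K)) with
    mul_assoc := FinitaryIncidenceAlgebra.mul_assoc
    one_mul := by
      classical
      intro α
      ext x y
      rw [coeff_mul, finsum_eq_single _ x fun z hz => by simp [coeff_one, hz.symm]]
      simp [coeff_one]
    mul_one := by
      classical
      intro α
      ext x y
      rw [coeff_mul, finsum_eq_single _ y fun z hz => by simp [coeff_one, hz]]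
      simp [coeff_one]
    zero_mul := by
      intro α
      ext x y
      simp [coeff_mul]
    mul_zero := by
      intro α
      ext x y
      simp [coeff_mul]
    left_distrib := by
      intro α β γ
      ext x y
      rw [coeff_add, coeff_mul, coeff_mul, coeff_mul,
        ← finsum_add_distrib (α.finite_conv β x y) (α.finite_conv γ x y)]
      simp [mul_add]
    right_distrib := by
      intro α β γ
      ext x y
      rw [coeff_add, coeff_mul, coeff_mul, coeff_mul,
        ← finsum_add_distrib (α.finite_conv γ x y) (β.finite_conv γ x y)]
      simp [add_mul] }

noncomputable instance : Algebra K (FinitaryIncidenceAlgebra X K) :=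
  Algebra.ofModule
    (by
      intro c α β
      ext x y
      rw [coeff_smul, coeff_mul, coeff_mul, mul_finsum' _ c (α.finite_conv β x y)]
      simp [mul_assoc])
    (by
      intro c α β
      ext x y
      rw [coeff_smul, coeff_mul, coeff_mul, mul_finsum' _ c (α.finite_conv β x y)]
      simp [mul_left_comm])

end Construction

end FinitaryIncidenceAlgebra

/-- The `K`-algebra `A` satisfies a polynomial identity: some non-zero element of the free algebra
`K⟨x₀, x₁, …⟩` vanishes under every substitution of elements of `A` for the variables. -/
def SatisfiesPolynomialIdentity (K A : Type*) [Field K] [Ring A] [Algebra K A] : Prop :=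
  ∃ f : FreeAlgebra K ℕ, f ≠ 0 ∧ ∀ a : ℕ → A, FreeAlgebra.lift K a f = 0

/-- The group `G` satisfies a group identity: some non-trivial word in the free group on
`x₀, x₁, …` takes the value `1` under every substitution of elements of `G`. -/
def SatisfiesGroupIdentity (G : Type*) [Group G] : Prop :=
  ∃ w : FreeGroup ℕ, w ≠ 1 ∧ ∀ g : ℕ → G, FreeGroup.lift g w = 1

section

attribute [local instance] LieRing.ofAssociativeRing

/-- `A` is Lie solvable: the Lie derived series `A^[0] = A`, `A^[n+1] = [A^[n], A^[n]]` of `A` with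
the bracket `⁅a, b⁆ = a * b - b * a` reaches `0`. -/
def IsLieSolvable (K A : Type*) [Field K] [Ring A] [Algebra K A] : Prop :=
  ∃ n : ℕ, LieAlgebra.derivedSeries K A n = ⊥

end

/-- The series `A^(0) = A`, `A^(n+1) = [A^(n), A^(n)] A`, where `[U, V]` and `U V` denote the
linear spans of all `[u, v]` and of all `u v`. -/
def strongLieDerivedSeries (K A : Type*) [Field K] [Ring A] [Algebra K A] : ℕ → Submodule K A
  | 0 => ⊤
  | n + 1 =>
    Submodule.span K {c : A | ∃ a ∈ strongLieDerivedSeries K A n,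
      ∃ b ∈ strongLieDerivedSeries K A n, a * b - b * a = c} * ⊤

/-- `A` is strongly Lie solvable: `A^(n) = 0` for some `n`. -/
def IsStronglyLieSolvable (K A : Type*) [Field K] [Ring A] [Algebra K A] : Prop :=
  ∃ n : ℕ, strongLieDerivedSeries K A n = ⊥

/-- A poset is bounded if its length, the supremum of `|C| - 1` over its finite chains `C`, is
finite. (`Order.krullDim X` is the supremum of the numbers `n` over the chains
`x₀ < x₁ < ⋯ < xₙ`, with value `⊥` for the empty poset.) -/
def IsBoundedPoset (X : Type*) [PartialOrder X] : Prop :=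
  Order.krullDim X < ⊤

/-! Everything hinges on how long the chains of `X` are.

If `X` is bounded, filter the algebra by the ideals `chainFiltration X K k`. They are multiplicative
because chains concatenate (`mul_mem_chainFiltration`), and they vanish for large `k`. A commutator
of two elements of the `k`-th ideal lies in the next one (`sub_mem_chainFiltration`): for `k = 0`
because diagonals multiply pointwise in the commutative field `K`, for `k > 0` because indices add.
Hence the strong Lie derived series reaches zero, some power of `[x₀, x₁]` is a polynomial identity,
and the congruence subgroups show that the unit group is solvable.

If `X` is unbounded, chains of every length give systems of triangular matrix units of every size
(`exists_isTriangularUnits`), and each of the other conditions fails. For Lie solvability, write `E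
i j` as a bracket of shorter units. For a polynomial or group identity, take a monomial or reduced
word of length `n` and substitute for each letter a matrix stepping from `j` to `j + 1` exactly
where that letter stands at position `j`: the corner entry `(0, n)` then reads off the monomial
(`row_mul_word`) or detects the word (`row_mul_prefix`).

The remaining links are general: strongly Lie solvable implies Lie solvable, and a solvable group
satisfies a group identity. -/

/-- Elements `E i j`, `i ≤ j ≤ n`, of a ring that multiply like the upper triangular matrix units
of size `n + 1`, with `E 0 n ≠ 0`. -/
structure IsTriangularUnits {R : Type*} [Ring R] (n : ℕ) (E : ℕ → ℕ → R) : Prop where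
  mul_same : ∀ {i j k : ℕ}, i ≤ j → j ≤ k → k ≤ n → E i j * E j k = E i k
  mul_ne : ∀ {i j k l : ℕ}, i ≤ j → j ≤ n → k ≤ l → l ≤ n → j ≠ k → E i j * E k l = 0
  ne_zero : E 0 n ≠ 0

/-- The sum of the superdiagonal units `E j (j + 1)` over `j < n` with `p j`. -/
noncomputable def superdiagonalSum {R : Type*} [Ring R] (E : ℕ → ℕ → R) (n : ℕ)
    (p : ℕ → Prop) : R :=
  open Classical in ∑ j ∈ Finset.range n, if p j then E j (j + 1) else 0

/-- The idempotent `E j j + ⋯ + E n n`. -/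
def tailIdempotent {R : Type*} [Ring R] (E : ℕ → ℕ → R) (n j : ℕ) : R :=
  ∑ k ∈ Finset.Icc j n, E k k

/-! ### Superdiagonal matrices and the words they detect -/

namespace IsTriangularUnits

variable {R : Type*} [Ring R] {n : ℕ} {E : ℕ → ℕ → R}

open Classical in
theorem mul_superdiagonalSum (h : IsTriangularUnits n E) (p : ℕ → Prop) {i j : ℕ}
    (hij : i ≤ j) (hj : j ≤ n) :
    E i j * superdiagonalSum E n p = if j < n ∧ p j then E i (j + 1) else 0 := by
  rw [superdiagonalSum, Finset.mul_sum]
  split_ifs with hp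
  · rw [Finset.sum_eq_single_of_mem j (Finset.mem_range.2 hp.1), if_pos hp.2]
    · exact h.mul_same hij (Nat.le_succ j) hp.1
    · intro k hk hkj
      rw [mul_ite, mul_zero, ite_eq_right_iff]
      exact fun _ => h.mul_ne hij hj (Nat.le_succ k) (Finset.mem_range.1 hk) hkj.symm
  · refine Finset.sum_eq_zero fun k hk => ?_
    rw [Finset.mem_range] at hk
    rw [mul_ite, mul_zero, ite_eq_right_iff]
    exact fun hpk => h.mul_ne hij hj (Nat.le_succ k) hk fun e => hp (e ▸ ⟨hk, hpk⟩)

theorem tailIdempotent_mul (h : IsTriangularUnits n E) (j : ℕ) {k l : ℕ} (hkl : k ≤ l)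
    (hl : l ≤ n) : tailIdempotent E n j * E k l = if j ≤ k then E k l else 0 := by
  rw [tailIdempotent, Finset.sum_mul]
  split_ifs with hjk
  · rw [Finset.sum_eq_single_of_mem k (by simp; omega)]
    · exact h.mul_same le_rfl hkl hl
    · intro i hi hik
      exact h.mul_ne le_rfl (Finset.mem_Icc.1 hi).2 hkl hl hik
  · refine Finset.sum_eq_zero fun i hi => ?_
    rw [Finset.mem_Icc] at hi
    exact h.mul_ne le_rfl hi.2 hkl hl (by omega)

theorem mul_tailIdempotent (h : IsTriangularUnits n E) (j : ℕ) {k l : ℕ} (hkl : k ≤ l)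
    (hl : l ≤ n) : E k l * tailIdempotent E n j = if j ≤ l then E k l else 0 := by
  rw [tailIdempotent, Finset.mul_sum]
  split_ifs with hjk
  · rw [Finset.sum_eq_single_of_mem l (by simp; omega)]
    · exact h.mul_same hkl le_rfl hl
    · intro i hi hik
      exact h.mul_ne hkl hl le_rfl (Finset.mem_Icc.1 hi).2 hik.symm
  · refine Finset.sum_eq_zero fun i hi => ?_
    rw [Finset.mem_Icc] at hi
    exact h.mul_ne hkl hl le_rfl hi.2 (by omega)

theorem tailIdempotent_mul_tailIdempotent (h : IsTriangularUnits n E) {i j : ℕ} (hij : i ≤ j) :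
    tailIdempotent E n i * tailIdempotent E n j = tailIdempotent E n j := by
  conv_lhs => rw [tailIdempotent.eq_1 E n j, Finset.mul_sum]
  refine Finset.sum_congr rfl fun k hk => ?_
  rw [Finset.mem_Icc] at hk
  rw [h.tailIdempotent_mul i le_rfl hk.2, if_pos (by omega)]

theorem tailIdempotent_mul_superdiagonalSum (h : IsTriangularUnits n E) (p : ℕ → Prop) (j : ℕ) :
    tailIdempotent E n j * superdiagonalSum E n p =
      superdiagonalSum E n fun k => p k ∧ j ≤ k := by
  classical
  rw [superdiagonalSum, superdiagonalSum, Finset.mul_sum]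
  refine Finset.sum_congr rfl fun k hk => ?_
  rw [mul_ite, mul_zero, h.tailIdempotent_mul j (Nat.le_succ k) (Finset.mem_range.1 hk)]
  by_cases hp : p k <;> simp [hp]

theorem superdiagonalSum_mul_tailIdempotent (h : IsTriangularUnits n E) (p : ℕ → Prop) (j : ℕ) :
    superdiagonalSum E n p * tailIdempotent E n j =
      superdiagonalSum E n fun k => p k ∧ j ≤ k + 1 := by
  classical
  rw [superdiagonalSum, superdiagonalSum, Finset.sum_mul]
  refine Finset.sum_congr rfl fun k hk => ?_
  rw [ite_mul, zero_mul, h.mul_tailIdempotent j (Nat.le_succ k) (Finset.mem_range.1 hk)]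
  by_cases hp : p k <;> simp [hp]

/-- Without a step from `j` to `j + 1`, the superdiagonal sum is block diagonal. -/
theorem commute_tailIdempotent (h : IsTriangularUnits n E) {p : ℕ → Prop} {j : ℕ} (hp : ¬ p j) :
    Commute (superdiagonalSum E n p) (tailIdempotent E n (j + 1)) := by
  rw [Commute, SemiconjBy, h.tailIdempotent_mul_superdiagonalSum,
    h.superdiagonalSum_mul_tailIdempotent]
  congr 1
  funext k
  refine propext (and_congr_right fun hk => ?_)
  have : k ≠ j := by
    rintro rfl
    exact hp hk
  omega

theorem isNilpotent_superdiagonalSum (h : IsTriangularUnits n E) (p : ℕ → Prop) :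
    IsNilpotent (superdiagonalSum E n p) := by
  set N := superdiagonalSum E n p with hN
  -- The sum of all diagonal units need not be the identity of `R`, but it fixes `N`.
  have h0 : tailIdempotent E n 0 * N = N := by
    rw [hN, h.tailIdempotent_mul_superdiagonalSum]
    simp
  have hs : ∀ j, tailIdempotent E n j * N = tailIdempotent E n j * N * tailIdempotent E n (j + 1) := by
    intro j
    rw [hN, h.tailIdempotent_mul_superdiagonalSum, h.superdiagonalSum_mul_tailIdempotent]
    congr 1
    funext k
    simp
  have hpow : ∀ k, tailIdempotent E n 0 * N ^ k =
      tailIdempotent E n 0 * N ^ k * tailIdempotent E n k := by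
    intro k
    induction k with
    | zero => rw [pow_zero, mul_one, h.tailIdempotent_mul_tailIdempotent le_rfl]
    | succ k ih =>
      rw [pow_succ, ← mul_assoc, ih, mul_assoc _ _ N, hs k]
      simp only [mul_assoc]
      rw [h.tailIdempotent_mul_tailIdempotent le_rfl]
  refine ⟨n + 1, ?_⟩
  have he : tailIdempotent E n (n + 1) = 0 := by simp [tailIdempotent]
  have h1 : tailIdempotent E n 0 * N ^ (n + 1) = N ^ (n + 1) := by
    rw [pow_succ', ← mul_assoc, h0]
  rw [← h1, hpow, he, mul_zero]

theorem isUnit_one_add_superdiagonalSum (h : IsTriangularUnits n E) (p : ℕ → Prop) :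
    IsUnit (1 + superdiagonalSum E n p) :=
  (h.isNilpotent_superdiagonalSum p).isUnit_one_add

/-- The unit `1 + N` for a superdiagonal sum `N`. -/
noncomputable def superdiagonalUnit (h : IsTriangularUnits n E) (p : ℕ → Prop) : Rˣ :=
  (h.isUnit_one_add_superdiagonalSum p).unit

theorem val_superdiagonalUnit (h : IsTriangularUnits n E) (p : ℕ → Prop) :
    (h.superdiagonalUnit p : R) = 1 + superdiagonalSum E n p := rfl

theorem commute_inv_superdiagonalUnit (h : IsTriangularUnits n E) {p : ℕ → Prop} {j : ℕ}
    (hp : ¬ p j) :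
    Commute (↑(h.superdiagonalUnit p)⁻¹ : R) (tailIdempotent E n (j + 1)) := by
  refine Commute.units_inv_left ?_
  rw [val_superdiagonalUnit]
  exact (Commute.one_left _).add_left (h.commute_tailIdempotent hp)

/-- A row fixed by a unit is fixed by its inverse, so the inverse need not be expanded. -/
theorem mul_inv_superdiagonalUnit (h : IsTriangularUnits n E) {p : ℕ → Prop} {i j : ℕ}
    (hij : i ≤ j) (hj : j ≤ n) (hp : ¬ (j < n ∧ p j)) :
    E i j * (↑(h.superdiagonalUnit p)⁻¹ : R) = E i j := by
  rw [Units.mul_inv_eq_iff_eq_mul, val_superdiagonalUnit, mul_add, mul_one,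
    h.mul_superdiagonalSum p hij hj, if_neg hp, add_zero]

/-- Appending a letter that makes the step from `j` to `j + 1`, when its inverse makes neither
this step nor the next one. -/
theorem row_mul_step (h : IsTriangularUnits n E) {p q : ℕ → Prop} {j : ℕ} (hj : j < n)
    (hp : p j) (hq : ¬ q j) (hq' : ¬ (j + 1 < n ∧ q (j + 1))) {P : R}
    (hP : E 0 0 * P * tailIdempotent E n j = E 0 j) :
    E 0 0 * (P * (h.superdiagonalUnit p * (↑(h.superdiagonalUnit q)⁻¹ : R))) *
      tailIdempotent E n (j + 1) = E 0 (j + 1) := by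
  have hc := (h.commute_inv_superdiagonalUnit hq).eq
  -- The unit is bidiagonal: its columns from `j + 1` on involve only rows from `j` on.
  have hu : (h.superdiagonalUnit p : R) * tailIdempotent E n (j + 1) =
      tailIdempotent E n j * (h.superdiagonalUnit p * tailIdempotent E n (j + 1)) := by
    rw [val_superdiagonalUnit, add_mul, one_mul, mul_add,
      h.tailIdempotent_mul_tailIdempotent (Nat.le_succ j), h.superdiagonalSum_mul_tailIdempotent,
      h.tailIdempotent_mul_superdiagonalSum]
    congr 2
    funext k
    simp
  have hr : E 0 j * (h.superdiagonalUnit p * tailIdempotent E n (j + 1)) = E 0 (j + 1) := by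
    rw [val_superdiagonalUnit, ← mul_assoc, mul_add, mul_one, add_mul,
      h.mul_superdiagonalSum p (Nat.zero_le j) hj.le, if_pos ⟨hj, hp⟩,
      h.mul_tailIdempotent _ (Nat.zero_le _) hj.le, if_neg (by omega),
      h.mul_tailIdempotent _ (Nat.zero_le _) hj, if_pos le_rfl, zero_add]
  calc _ = E 0 0 * P * (h.superdiagonalUnit p * tailIdempotent E n (j + 1)) *
        (↑(h.superdiagonalUnit q)⁻¹ : R) := by
        simp only [mul_assoc]
        rw [hc]
    _ = E 0 0 * P * tailIdempotent E n j *
        (h.superdiagonalUnit p * tailIdempotent E n (j + 1)) *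
        (↑(h.superdiagonalUnit q)⁻¹ : R) := by
        rw [hu]
        simp only [mul_assoc]
        rw [← mul_assoc (tailIdempotent E n j) (tailIdempotent E n j),
          h.tailIdempotent_mul_tailIdempotent le_rfl]
    _ = E 0 (j + 1) := by
        rw [hP, hr, h.mul_inv_superdiagonalUnit (Nat.zero_le _) hj hq']

/-- The unit substituted for the letter `x` (or its inverse) to detect the word `L`. -/
noncomputable def letterUnit {α : Type*} {L : List (α × Bool)}
    (h : IsTriangularUnits L.length E) (x : α × Bool) : Rˣ :=
  h.superdiagonalUnit (fun j => L[j]? = some x) *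
    (h.superdiagonalUnit fun j => L[j]? = some (x.1, !x.2))⁻¹

/-- This is why `letterUnit` is a quotient: flipping the exponent swaps the two factors, so the
values on letters come from a homomorphism on the free group. -/
theorem letterUnit_not {α : Type*} {L : List (α × Bool)} (h : IsTriangularUnits L.length E)
    (a : α) (b : Bool) : h.letterUnit (a, !b) = (h.letterUnit (a, b))⁻¹ := by
  simp [letterUnit]

/-- Only columns from `j` on are controlled; entries further left are arbitrary but can no longer
matter. Reducedness makes the inverse factor of each letter harmless. -/
theorem row_mul_prefix {α : Type*} {L : List (α × Bool)} (h : IsTriangularUnits L.length E)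
    (hL : FreeGroup.IsReduced L) (j : ℕ) (hj : j ≤ L.length) :
    E 0 0 * (((L.take j).map h.letterUnit).prod : Rˣ) * tailIdempotent E L.length j = E 0 j := by
  induction j with
  | zero => simp [h.mul_tailIdempotent 0 le_rfl (Nat.zero_le _)]
  | succ j ih =>
    rw [List.take_succ_eq_append_getElem hj, List.map_append, List.prod_append, Units.val_mul,
      List.map_singleton, List.prod_singleton, letterUnit, Units.val_mul]
    refine h.row_mul_step hj (List.getElem?_eq_getElem hj) ?_ ?_ (ih (Nat.le_of_succ_le hj))
    -- Position `j` holds the letter itself, hence not its inverse.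
    · rw [List.getElem?_eq_getElem hj, Option.some_inj, Prod.ext_iff]
      simp
    -- The inverse letter at position `j + 1` would cancel, contrary to reducedness.
    · rintro ⟨hj', hq⟩
      rw [List.getElem?_eq_getElem hj', Option.some_inj] at hq
      have := List.isChain_iff_getElem.1 hL j hj'
      rw [hq] at this
      simpa using this rfl

/-- A non-trivial reduced word does not vanish on the units of a ring with sufficiently many
triangular matrix units. -/
theorem exists_lift_ne_one {w : FreeGroup ℕ} (hw : w ≠ 1)
    (h : IsTriangularUnits w.toWord.length E) : ∃ g : ℕ → Rˣ, FreeGroup.lift g w ≠ 1 := by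
  refine ⟨fun i => h.letterUnit (i, true), fun hg => h.ne_zero ?_⟩
  have hrow := h.row_mul_prefix FreeGroup.isReduced_toWord _ le_rfl
  have hmap : (w.toWord.map h.letterUnit).prod = 1 := by
    rw [← hg]
    refine Eq.trans ?_ (congrArg _ (FreeGroup.mk_toWord (x := w)))
    rw [FreeGroup.lift_mk]
    congr 2
    funext ⟨a, b⟩
    cases b
    · exact h.letterUnit_not a true
    · rfl
  -- With value `1` the row is `E 0 0` cut off at the last column, which is zero as the word is
  -- nonempty.
  rw [List.take_length, hmap, Units.val_one, mul_one, h.mul_tailIdempotent _ le_rfl (Nat.zero_le _),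
    if_neg] at hrow
  · exact hrow.symm
  · rw [Nat.le_zero, List.length_eq_zero_iff, FreeGroup.toWord_eq_nil_iff]
    exact hw

/-- Each factor advances the column index if it matches the current letter of `w` and kills the row
otherwise; the final `E w.length w.length` demands that the end be reached. -/
theorem row_mul_word {α : Type*} {w : List α} (h : IsTriangularUnits w.length E) (l : List α)
    (i : ℕ) (hi : i ≤ w.length) [Decidable (w.drop i = l)] :
    E 0 i * (l.map fun x => superdiagonalSum E w.length fun j => w[j]? = some x).prod *
      E w.length w.length = if w.drop i = l then E 0 w.length else 0 := by
  classical
  induction l generalizing i with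
  | nil =>
    rw [List.map_nil, List.prod_nil, mul_one]
    split_ifs with hd
    · obtain rfl : i = w.length := le_antisymm hi (List.drop_eq_nil_iff.1 hd)
      exact h.mul_same (Nat.zero_le _) le_rfl le_rfl
    · exact h.mul_ne (Nat.zero_le _) hi le_rfl le_rfl fun e => hd (by simp [e])
  | cons x l ih =>
    rw [List.map_cons, List.prod_cons, ← mul_assoc, h.mul_superdiagonalSum _ (Nat.zero_le _) hi]
    by_cases hx : i < w.length ∧ w[i]? = some x
    · obtain ⟨hi', hx⟩ := hx
      rw [if_pos ⟨hi', hx⟩, ih _ hi']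
      rw [List.getElem?_eq_getElem hi', Option.some_inj] at hx
      simp [List.drop_eq_getElem_cons hi', hx]
    · rw [if_neg hx, zero_mul, zero_mul, if_neg]
      intro hd
      have := congrArg (·[0]?) hd
      simp at this
      exact hx ⟨(List.getElem?_eq_some_iff.1 this).1, this⟩

end IsTriangularUnits

/-! ### Obstructions from triangular units of every size -/

theorem FreeAlgebra.lift_eq_sum {K A : Type*} [Field K] [Ring A] [Algebra K A] (a : ℕ → A)
    (f : FreeAlgebra K ℕ) :
    FreeAlgebra.lift K a f = (FreeAlgebra.equivMonoidAlgebraFreeMonoid f).coeff.sum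
      fun m c => c • (m.toList.map a).prod := by
  have : FreeAlgebra.lift K a = (MonoidAlgebra.lift K A (FreeMonoid ℕ) (FreeMonoid.lift a)).comp
      (FreeAlgebra.equivMonoidAlgebraFreeMonoid (R := K) (X := ℕ)).toAlgHom := by
    ext i
    simp [FreeAlgebra.equivMonoidAlgebraFreeMonoid]
  rw [this, AlgHom.comp_apply, MonoidAlgebra.lift_apply]
  simp only [FreeMonoid.lift_apply]
  rfl

theorem not_satisfiesPolynomialIdentity_of_triangularUnits {K A : Type*} [Field K] [Ring A]
    [Algebra K A] (h : ∀ n, ∃ E : ℕ → ℕ → A, IsTriangularUnits n E) :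
    ¬ SatisfiesPolynomialIdentity K A := by
  classical
  rintro ⟨f, hf, hfa⟩
  set g := FreeAlgebra.equivMonoidAlgebraFreeMonoid f with hg
  have hg0 : g ≠ 0 := by simpa [hg] using hf
  obtain ⟨m, hm⟩ : ∃ m, g.coeff m ≠ 0 := by
    by_contra! H
    exact hg0 (MonoidAlgebra.ext (Finsupp.ext H))
  obtain ⟨E, hE⟩ := h m.toList.length
  have key := hfa fun x => superdiagonalSum E m.toList.length fun j => m.toList[j]? = some x
  rw [FreeAlgebra.lift_eq_sum, ← hg] at key
  -- Sandwiching kills every monomial except `m`, leaving its coefficient times the corner unit.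
  have key' := congrArg (fun r => E 0 0 * r * E m.toList.length m.toList.length) key
  simp only [Finsupp.sum, Finset.mul_sum, Finset.sum_mul, mul_zero, zero_mul, mul_smul_comm,
    smul_mul_assoc, hE.row_mul_word _ 0 (Nat.zero_le _), List.drop_zero] at key'
  rw [Finset.sum_eq_single_of_mem m (Finsupp.mem_support_iff.2 hm), if_pos rfl] at key'
  · exact (smul_ne_zero hm hE.ne_zero) key'
  · intro b _ hb
    rw [if_neg fun e => hb (FreeMonoid.toList.injective e.symm), smul_zero]

theorem not_isLieSolvable_of_triangularUnits {K A : Type*} [Field K] [Ring A]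
    [Algebra K A] (h : ∀ n, ∃ E : ℕ → ℕ → A, IsTriangularUnits n E) :
    ¬ IsLieSolvable K A := by
  let _ := LieRing.ofAssociativeRing (A := A)
  rintro ⟨m, hm⟩
  -- Splitting `E i j` at `i + 2 ^ k` leaves two units of gap at least `2 ^ k`, so each derived step
  -- costs a factor of two.
  obtain ⟨E, hE⟩ := h (2 ^ m)
  have key : ∀ k i j, i + 2 ^ k ≤ j → j ≤ 2 ^ m → E i j ∈ LieAlgebra.derivedSeries K A k := by
    intro k
    induction k with
    | zero => intro i j _ _; exact LieSubmodule.mem_top _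
    | succ k ih =>
      intro i j hij hj
      rw [pow_succ] at hij
      have e : E i j = ⁅E i (i + 2 ^ k), E (i + 2 ^ k) j⁆ := by
        have := Nat.two_pow_pos k
        rw [LieRing.of_associative_ring_bracket, hE.mul_same (by omega) (by omega) hj,
          hE.mul_ne (by omega) hj (by omega) (by omega) (by omega), sub_zero]
      rw [e, LieAlgebra.derivedSeries_def, LieAlgebra.derivedSeriesOfIdeal_succ]
      exact LieSubmodule.lie_mem_lie (ih _ _ le_rfl (by omega)) (ih _ _ (by omega) hj)
  have := key m 0 (2 ^ m) (by omega) le_rfl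
  rw [hm, LieSubmodule.mem_bot] at this
  exact hE.ne_zero this

theorem not_satisfiesGroupIdentity_of_triangularUnits {R : Type*} [Ring R]
    (h : ∀ n, ∃ E : ℕ → ℕ → R, IsTriangularUnits n E) : ¬ SatisfiesGroupIdentity Rˣ := by
  rintro ⟨w, hw, hg⟩
  obtain ⟨E, hE⟩ := h w.toWord.length
  obtain ⟨g, hne⟩ := hE.exists_lift_ne_one hw
  exact hne (hg g)

/-! ### Implications valid for all groups and algebras -/

theorem FreeGroup.not_isSolvable_nat : ¬ Group.IsSolvable (FreeGroup ℕ) := by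
  intro _
  -- The free group of countable rank maps onto the non-solvable group `S₅`.
  obtain ⟨f, hf⟩ := exists_surjective_nat (Equiv.Perm (Fin 5))
  exact Equiv.Perm.not_isSolvable_fin_5
    (Group.isSolvable_of_surjective (FreeGroup.lift_surjective_of_surjective hf))

/-- Any nontrivial word in a derived subgroup of the free group, of index the derived length of `G`,
is an identity. -/
theorem Group.IsSolvable.satisfiesGroupIdentity {G : Type*} [Group G] (h : Group.IsSolvable G) :
    SatisfiesGroupIdentity G := by
  obtain ⟨n, hn⟩ := h
  obtain ⟨w, hw, hw1⟩ : ∃ w ∈ derivedSeries (FreeGroup ℕ) n, w ≠ 1 := by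
    by_contra! H
    exact FreeGroup.not_isSolvable_nat ⟨n, (Subgroup.eq_bot_iff_forall _).2 H⟩
  refine ⟨w, hw1, fun g => ?_⟩
  have := map_derivedSeries_le_derivedSeries (FreeGroup.lift g) n (Subgroup.mem_map_of_mem _ hw)
  rwa [hn, Subgroup.mem_bot] at this

theorem IsStronglyLieSolvable.isLieSolvable {K A : Type*} [Field K] [Ring A] [Algebra K A]
    (h : IsStronglyLieSolvable K A) : IsLieSolvable K A := by
  let _ := LieRing.ofAssociativeRing (A := A)
  have key : ∀ k, (LieAlgebra.derivedSeries K A k).toSubmodule ≤ strongLieDerivedSeries K A k := by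
    intro k
    induction k with
    | zero => exact le_top
    | succ k ih =>
      rw [LieAlgebra.derivedSeries_def, LieAlgebra.derivedSeriesOfIdeal_succ,
        LieSubmodule.lieIdeal_oper_eq_linear_span', Submodule.span_le]
      rintro _ ⟨a, ha, b, hb, rfl⟩
      rw [strongLieDerivedSeries, SetLike.mem_coe, ← mul_one ⁅a, b⁆]
      exact Submodule.mul_mem_mul (Submodule.subset_span ⟨a, ih ha, b, ih hb, rfl⟩) trivial
  obtain ⟨n, hn⟩ := h
  refine ⟨n, ?_⟩
  rw [← LieSubmodule.toSubmodule_eq_bot, ← le_bot_iff, ← hn]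
  exact key n

/-! ### Matrix units along a chain -/

namespace FinitaryIncidenceAlgebra

variable {X K : Type*} [PartialOrder X]

section MatrixUnits

variable [CommRing K]

open Classical in
/-- The element `e_{xy}`, read as `0` unless `x ≤ y`. -/
noncomputable def matrixUnit (x y : X) : FinitaryIncidenceAlgebra X K :=
  ⟨⟨fun u v => if u = x ∧ v = y ∧ x ≤ y then 1 else 0, fun u v h => if_neg (by
    rintro ⟨rfl, rfl, h'⟩
    exact h h')⟩, by
    intro a b _
    refine (Set.finite_singleton (x, y)).subset ?_
    rintro ⟨u, v⟩ ⟨-, -, -, h⟩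
    by_contra hne
    refine h (if_neg ?_)
    rintro ⟨rfl, rfl, -⟩
    exact hne rfl⟩

open Classical in
theorem coeff_matrixUnit (x y u v : X) :
    (matrixUnit x y : FinitaryIncidenceAlgebra X K).coeff u v =
      if u = x ∧ v = y ∧ x ≤ y then 1 else 0 := rfl

theorem matrixUnit_mul_same {x y z : X} (hxy : x ≤ y) (hyz : y ≤ z) :
    (matrixUnit x y : FinitaryIncidenceAlgebra X K) * matrixUnit y z = matrixUnit x z := by
  ext u v
  rw [coeff_mul, finsum_eq_single _ y fun w hw => by simp [coeff_matrixUnit, hw]]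
  simp only [coeff_matrixUnit, hxy, hyz, hxy.trans hyz, and_true, true_and, ite_and, ite_mul,
    one_mul, zero_mul, if_true]

theorem matrixUnit_mul_ne {x y z w : X} (hyz : y ≠ z) :
    (matrixUnit x y : FinitaryIncidenceAlgebra X K) * matrixUnit z w = 0 := by
  ext u v
  rw [coeff_mul]
  refine finsum_eq_zero_of_forall_eq_zero fun t => ?_
  by_cases ht : t = y
  · simp [coeff_matrixUnit, ht, hyz]
  · simp [coeff_matrixUnit, ht]

theorem matrixUnit_ne_zero [Nontrivial K] {x y : X} (h : x ≤ y) :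
    (matrixUnit x y : FinitaryIncidenceAlgebra X K) ≠ 0 := by
  intro e
  have := congrArg (fun α => coeff α x y) e
  simp [coeff_matrixUnit, h] at this

theorem exists_isTriangularUnits [Nontrivial K] (h : ¬ IsBoundedPoset X) (n : ℕ) :
    ∃ E : ℕ → ℕ → FinitaryIncidenceAlgebra X K, IsTriangularUnits n E := by
  rw [IsBoundedPoset, not_lt_top_iff] at h
  obtain ⟨p, hp⟩ := Order.le_krullDim_iff.1 (h ▸ le_top : (n : WithBot ℕ∞) ≤ Order.krullDim X)
  -- Truncating with `min` makes the chain a function on all of `ℕ`; indices up to `n` are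
  -- unaffected.
  have hc : ∀ i j, i ≤ j →
      p ⟨min i p.length, by omega⟩ ≤ p ⟨min j p.length, by omega⟩ := fun i j hij =>
    p.monotone (Fin.mk_le_mk.2 (min_le_min_right _ hij))
  refine ⟨fun i j => matrixUnit (p ⟨min i p.length, by omega⟩) (p ⟨min j p.length, by omega⟩),
    fun hij hjk _ => matrixUnit_mul_same (hc _ _ hij) (hc _ _ hjk),
    fun _ hj hkl hl hjk => matrixUnit_mul_ne fun e => ?_,
    matrixUnit_ne_zero (hc _ _ (Nat.zero_le n))⟩
  have := congrArg Fin.val (p.strictMono.injective e)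
  simp only at this
  omega

end MatrixUnits

/-! ### The filtration by chain length, for bounded posets -/

section ChainFiltration

variable [Field K]

variable (X K) in
/-- The series supported on the pairs `x ≤ y` that are joined by a chain of length at least `k`. -/
def chainFiltration (k : ℕ) : Submodule K (FinitaryIncidenceAlgebra X K) where
  carrier := {α | ∀ x y, α.coeff x y ≠ 0 →
    ∃ p : LTSeries X, p.head = x ∧ p.last = y ∧ k ≤ p.length}
  zero_mem' x y h := absurd (coeff_zero x y) h
  add_mem' {α β} hα hβ x y h := by
    by_cases hx : α.coeff x y = 0
    · exact hβ x y fun hy => h (by rw [coeff_add, hx, hy, add_zero])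
    · exact hα x y hx
  smul_mem' c α hα x y h := hα x y (right_ne_zero_of_mul h)

theorem chainFiltration_antitone : Antitone (chainFiltration X K) := fun _ _ hkl _ hα x y h =>
  let ⟨p, h1, h2, h3⟩ := hα x y h
  ⟨p, h1, h2, hkl.trans h3⟩

theorem mul_mem_chainFiltration {k l : ℕ} {α β : FinitaryIncidenceAlgebra X K}
    (hα : α ∈ chainFiltration X K k) (hβ : β ∈ chainFiltration X K l) :
    α * β ∈ chainFiltration X K (k + l) := by
  intro x y h
  obtain ⟨z, hz⟩ : ∃ z, α.coeff x z * β.coeff z y ≠ 0 := by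
    by_contra! H
    exact h (finsum_eq_zero_of_forall_eq_zero H)
  obtain ⟨p, rfl, hp, hpk⟩ := hα x z (left_ne_zero_of_mul hz)
  obtain ⟨q, hq, rfl, hql⟩ := hβ z y (right_ne_zero_of_mul hz)
  exact ⟨p.smash q (hp.trans hq.symm), RelSeries.head_smash _, RelSeries.last_smash _,
    add_le_add hpk hql⟩

theorem exists_ltSeries {x y : X} (h : x < y) :
    ∃ p : LTSeries X, p.head = x ∧ p.last = y ∧ 1 ≤ p.length :=
  ⟨LTSeries.mk 1 ![x, y] (by simpa [Fin.strictMono_iff_lt_succ] using h), rfl, rfl, le_rfl⟩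

theorem chainFiltration_zero : chainFiltration X K 0 = ⊤ := by
  refine (Submodule.eq_top_iff').2 fun α x y h => ?_
  rcases (α.le_of_coeff_ne_zero h).eq_or_lt with rfl | hxy
  · exact ⟨RelSeries.singleton _ x, rfl, rfl, Nat.zero_le _⟩
  · obtain ⟨p, h1, h2, -⟩ := exists_ltSeries hxy
    exact ⟨p, h1, h2, Nat.zero_le _⟩

theorem mul_mem_chainFiltration_left {k : ℕ} (α : FinitaryIncidenceAlgebra X K)
    {β : FinitaryIncidenceAlgebra X K} (hβ : β ∈ chainFiltration X K k) :
    α * β ∈ chainFiltration X K k := by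
  rw [← Nat.zero_add k]
  exact mul_mem_chainFiltration (chainFiltration_zero (X := X) (K := K) ▸ Submodule.mem_top) hβ

theorem mul_mem_chainFiltration_right {k : ℕ} {α : FinitaryIncidenceAlgebra X K}
    (hα : α ∈ chainFiltration X K k) (β : FinitaryIncidenceAlgebra X K) :
    α * β ∈ chainFiltration X K k :=
  mul_mem_chainFiltration (l := 0) hα (chainFiltration_zero (X := X) (K := K) ▸ Submodule.mem_top)

theorem coeff_mul_self (α β : FinitaryIncidenceAlgebra X K) (x : X) :
    (α * β).coeff x x = α.coeff x x * β.coeff x x := by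
  rw [coeff_mul]
  refine finsum_eq_single _ x fun z hz => ?_
  by_cases h : x ≤ z
  · rw [β.coeff_of_not_le fun h' => hz (le_antisymm h' h), mul_zero]
  · rw [α.coeff_of_not_le h, zero_mul]

theorem sub_mem_chainFiltration_one (α β : FinitaryIncidenceAlgebra X K) :
    α * β - β * α ∈ chainFiltration X K 1 := by
  intro x y h
  rcases (le_of_coeff_ne_zero _ h).eq_or_lt with rfl | hxy
  · refine absurd ?_ h
    have h1 : (α * β - β * α).coeff x x + (β * α).coeff x x = (α * β).coeff x x := by
      rw [← coeff_add, sub_add_cancel]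
    rw [coeff_mul_self, coeff_mul_self, mul_comm (β.coeff x x)] at h1
    exact left_eq_add.1 (h1.symm.trans (add_comm _ _))
  · exact exists_ltSeries hxy

theorem sub_mem_chainFiltration {k : ℕ} {α β : FinitaryIncidenceAlgebra X K}
    (hα : α ∈ chainFiltration X K k) (hβ : β ∈ chainFiltration X K k) :
    α * β - β * α ∈ chainFiltration X K (k + 1) := by
  cases k with
  | zero => exact sub_mem_chainFiltration_one α β
  | succ k =>
    -- Here both products already have index `2 * (k + 1) ≥ k + 2`; no cancellation is needed.
    exact chainFiltration_antitone (by omega)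
      (sub_mem (mul_mem_chainFiltration hα hβ) (mul_mem_chainFiltration hβ hα))

theorem exists_chainFiltration_eq_bot (h : IsBoundedPoset X) :
    ∃ n, chainFiltration X K n = ⊥ := by
  obtain ⟨n, hn⟩ : ∃ n : ℕ, ∀ p : LTSeries X, p.length < n := by
    by_contra! H
    refine h.ne (ENat.WithBot.eq_top_iff_forall_ge.2 fun n => ?_)
    obtain ⟨p, hp⟩ := H n
    exact (by exact_mod_cast hp : (n : WithBot ℕ∞) ≤ p.length).trans
      (Order.LTSeries.length_le_krullDim p)
  refine ⟨n, (Submodule.eq_bot_iff _).2 fun α hα => ?_⟩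
  ext x y
  by_contra hxy
  obtain ⟨p, -, -, hp⟩ := hα x y hxy
  exact hp.not_gt (hn p)

/-- The filtration terms are ideals, so the extra right factor in the series costs nothing. -/
theorem isStronglyLieSolvable (h : IsBoundedPoset X) :
    IsStronglyLieSolvable K (FinitaryIncidenceAlgebra X K) := by
  have key : ∀ k, strongLieDerivedSeries K (FinitaryIncidenceAlgebra X K) k ≤
      chainFiltration X K k := by
    intro k
    induction k with
    | zero => exact chainFiltration_zero.ge
    | succ k ih =>
      rw [strongLieDerivedSeries, Submodule.mul_le]
      intro α hα β _
      refine mul_mem_chainFiltration_right ?_ β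
      refine (Submodule.span_le.2 ?_) hα
      rintro _ ⟨a, ha, b, hb, rfl⟩
      exact sub_mem_chainFiltration (ih ha) (ih hb)
  obtain ⟨n, hn⟩ := exists_chainFiltration_eq_bot (K := K) h
  exact ⟨n, le_bot_iff.1 (hn ▸ key n)⟩

theorem satisfiesPolynomialIdentity (h : IsBoundedPoset X) :
    SatisfiesPolynomialIdentity K (FinitaryIncidenceAlgebra X K) := by
  obtain ⟨n, hn⟩ := exists_chainFiltration_eq_bot (K := K) h
  let c : FreeAlgebra K ℕ := FreeAlgebra.ι K 0 * FreeAlgebra.ι K 1 -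
    FreeAlgebra.ι K 1 * FreeAlgebra.ι K 0
  have hc : c ≠ 0 := by
    intro hc
    -- The matrix units `e₁₂` and `e₂₁` do not commute, so the commutator is nonzero; its powers are
    -- nonzero because the free algebra has no zero divisors.
    let a : ℕ → Matrix (Fin 2) (Fin 2) K := fun i => if i = 0 then !![0, 1; 0, 0] else !![0, 0; 1, 0]
    have := congrArg (fun r => FreeAlgebra.lift K a r 0 0) hc
    simp [c, a] at this
  refine ⟨c ^ n, pow_ne_zero n hc, fun a => ?_⟩
  have key : ∀ k, (FreeAlgebra.lift K a c) ^ k ∈ chainFiltration X K k := by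
    intro k
    induction k with
    | zero => exact chainFiltration_zero (X := X) (K := K) ▸ Submodule.mem_top
    | succ k ih =>
      rw [pow_succ]
      refine mul_mem_chainFiltration ih ?_
      simpa [c] using sub_mem_chainFiltration_one (a 0) (a 1)
  have := key n
  rwa [hn, Submodule.mem_bot, ← map_pow] at this

variable (X K) in
/-- The units that are congruent to `1` modulo `chainFiltration X K k`. -/
def congruenceSubgroup (k : ℕ) : Subgroup (FinitaryIncidenceAlgebra X K)ˣ where
  carrier := {u | (u : FinitaryIncidenceAlgebra X K) - 1 ∈ chainFiltration X K k}
  one_mem' := by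
    rw [Set.mem_ofPred_eq, Units.val_one, sub_self]
    exact zero_mem _
  mul_mem' {u v} hu hv := by
    have e : ((u * v : (FinitaryIncidenceAlgebra X K)ˣ) : FinitaryIncidenceAlgebra X K) - 1 =
        (u - 1) * v + (v - 1) := by
      rw [Units.val_mul]
      noncomm_ring
    rw [Set.mem_ofPred_eq, e]
    exact add_mem (mul_mem_chainFiltration_right hu _) hv
  inv_mem' {u} hu := by
    have e : ((u⁻¹ : (FinitaryIncidenceAlgebra X K)ˣ) : FinitaryIncidenceAlgebra X K) - 1 =
        -(↑u⁻¹ * (u - 1)) := by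
      rw [mul_sub, Units.inv_mul, mul_one, neg_sub]
    rw [Set.mem_ofPred_eq, e]
    exact neg_mem (mul_mem_chainFiltration_left _ hu)

theorem mem_congruenceSubgroup {k : ℕ} {u : (FinitaryIncidenceAlgebra X K)ˣ} :
    u ∈ congruenceSubgroup X K k ↔
      (u : FinitaryIncidenceAlgebra X K) - 1 ∈ chainFiltration X K k := Iff.rfl

open scoped commutatorElement in
theorem derivedSeries_units_le (k : ℕ) :
    derivedSeries (FinitaryIncidenceAlgebra X K)ˣ k ≤ congruenceSubgroup X K k := by
  induction k with
  | zero =>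
    intro u _
    rw [mem_congruenceSubgroup, chainFiltration_zero]
    exact Submodule.mem_top
  | succ k ih =>
    rw [derivedSeries_succ, Subgroup.commutator_le]
    intro u hu v hv
    -- Since `uv - vu` is unchanged when `1` is subtracted from `u` and `v`, the group commutator
    -- inherits the bound on additive commutators.
    have e : ((⁅u, v⁆ : (FinitaryIncidenceAlgebra X K)ˣ) : FinitaryIncidenceAlgebra X K) - 1 =
        (((u : FinitaryIncidenceAlgebra X K) - 1) * (v - 1) - (v - 1) * (u - 1)) *
          ↑(v * u)⁻¹ := by
      have : ((u : FinitaryIncidenceAlgebra X K) - 1) * (v - 1) - (v - 1) * (u - 1) =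
          ↑(u * v) - ↑(v * u) := by
        rw [Units.val_mul, Units.val_mul]
        noncomm_ring
      rw [this, sub_mul, Units.mul_inv, ← Units.val_mul, mul_inv_rev, ← mul_assoc]
      rfl
    rw [mem_congruenceSubgroup, e]
    exact mul_mem_chainFiltration_right (sub_mem_chainFiltration (ih hu) (ih hv)) _

theorem isSolvable_units (h : IsBoundedPoset X) :
    Group.IsSolvable (FinitaryIncidenceAlgebra X K)ˣ := by
  obtain ⟨n, hn⟩ := exists_chainFiltration_eq_bot (K := K) h
  refine ⟨n, (Subgroup.eq_bot_iff_forall _).2 fun u hu => Units.ext ?_⟩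
  have := derivedSeries_units_le n hu
  rwa [mem_congruenceSubgroup, hn, Submodule.mem_bot, sub_eq_zero] at this

end ChainFiltration

end FinitaryIncidenceAlgebra

theorem theorem1p3 {X K : Type*} [PartialOrder X] [Field K] :
    List.TFAE [
      SatisfiesPolynomialIdentity K (FinitaryIncidenceAlgebra X K),
      IsLieSolvable K (FinitaryIncidenceAlgebra X K),
      IsStronglyLieSolvable K (FinitaryIncidenceAlgebra X K),
      SatisfiesGroupIdentity (FinitaryIncidenceAlgebra X K)ˣ,
      Group.IsSolvable (FinitaryIncidenceAlgebra X K)ˣ,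
      IsBoundedPoset X] := by
  tfae_have 6 → 1 := FinitaryIncidenceAlgebra.satisfiesPolynomialIdentity
  tfae_have 6 → 3 := FinitaryIncidenceAlgebra.isStronglyLieSolvable
  tfae_have 6 → 5 := FinitaryIncidenceAlgebra.isSolvable_units
  tfae_have 3 → 2 := IsStronglyLieSolvable.isLieSolvable
  tfae_have 5 → 4 := Group.IsSolvable.satisfiesGroupIdentity
  tfae_have 1 → 6 := fun h => by_contra fun hX =>
    not_satisfiesPolynomialIdentity_of_triangularUnits
      (FinitaryIncidenceAlgebra.exists_isTriangularUnits hX) h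
  tfae_have 2 → 6 := fun h => by_contra fun hX =>
    not_isLieSolvable_of_triangularUnits
      (FinitaryIncidenceAlgebra.exists_isTriangularUnits hX) h
  tfae_have 4 → 6 := fun h => by_contra fun hX =>
    not_satisfiesGroupIdentity_of_triangularUnits
      (FinitaryIncidenceAlgebra.exists_isTriangularUnits hX) h
  tfae_finish
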